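/- Let $\mathbb D=\{\lambda\in\mathbb C:|\lambda|<1\}$, and let $D\subset\mathbb C$ be a domain (a non-empty connected open set). Denote by $\mathcal O(D,\mathbb D)$ the set of holomorphic maps $D\to\mathbb D$, and let $\rho(a,b)=\operatorname{artanh}\left|\frac{a-b}{1-\bar b a}\right|$ be the hyperbolic distance on $\mathbb D$. Define $$c_D(z,w)=\sup\{\rho(F(z),F(w)):F\in\mathcal O(D,\mathbb D)\}\qquad(z,w\in D),$$ $$\gamma_D(w;X)=\sup\{|F'(w)X|:F\ \text{holomorphic on } D,\ \sup_D|F|\le 1,\ F(w)=0\}\qquad(w\in D,\ X\in\mathbb C),$$ and define $\gamma_{\mathbb D}$ in the same way for $\mathbb D$. A set $\mathcal C\subset\mathcal O(D,\mathbb D)$ is called a universal set for the infinitesimal Carathéodory extremal problem on $D$ if for all $w\in D$ and $X\in\mathbb C\setminus\{0\}$ there is $F\in\mathcal C$ with $\gamma_D(w;X)=\gamma_{\mathbb D}(F(w);F'(w)X)$. The domain $D$ is called $c$-finitely compact if for all $w\in D$ and $r>0$ the ball $\{z\in D:c_D(w,z)<r\}$ is relatively compact in $D$. **Theorem.** Suppose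 that $D$ has a finite universal set for the infinitesimal Carathéodory extremal problem. Then $D$ has a universal set for the infinitesimal Carathéodory extremal problem that consists of exactly one element. If, additionally, $D$ is $c$-finitely compact, then $D$ is biholomorphic to $\mathbb D$. -/

import Mathlib

open Set Metric Complex
open scoped ENNReal ComplexConjugate

noncomputable section

/-- A domain in the complex plane: a non-empty, connected, open set. -/
def IsPlanarDomain (D : Set ℂ) : Prop := IsOpen D ∧ IsConnected D

/-- The open unit disc as a subset of the plane. -/
def openUnitDisc : Set ℂ := ball (0 : ℂ) 1

/-- The holomorphic maps from `D` to the open unit disc. A map is represented by a function on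
the whole plane; its values outside `D` are never used. -/
def holToDisc (D : Set ℂ) : Set (ℂ → ℂ) :=
  {F | DifferentiableOn ℂ F D ∧ MapsTo F D openUnitDisc}

/-- The hyperbolic (Poincaré) distance on the unit disc. -/
def hypDist (a b : ℂ) : ℝ := Real.artanh (‖(a - b) / (1 - conj b * a)‖)

/-- The Carathéodory pseudodistance of `D`. The supremum is taken in `[0, ∞]`
(it is finite when `D` is a domain). -/
def caratheodoryDist (D : Set ℂ) (z w : ℂ) : ℝ≥0∞ :=
  ⨆ F ∈ holToDisc D, ENNReal.ofReal (hypDist (F z) (F w))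

/-- The Reiffen-Carathéodory pseudometric of `D`: the supremum of `|F'(w) X|` over the bounded
holomorphic functions `F` on `D` with `‖F‖ ≤ 1` and `F(w) = 0`. The supremum is taken in `[0, ∞]`
(it is finite when `D` is open and `w` lies in `D`). -/
def reiffenMetric (D : Set ℂ) (w X : ℂ) : ℝ≥0∞ :=
  ⨆ F ∈ {F : ℂ → ℂ | DifferentiableOn ℂ F D ∧ (∀ z ∈ D, ‖F z‖ ≤ 1) ∧ F w = 0},
    ENNReal.ofReal ‖deriv F w * X‖

/-- `C` is a universal set for the infinitesimal Carathéodory extremal problem on `D`. -/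
def IsInfinitesimalUniversalSet (D : Set ℂ) (C : Set (ℂ → ℂ)) : Prop :=
  C ⊆ holToDisc D ∧
    ∀ w ∈ D, ∀ X : ℂ, X ≠ 0 →
      ∃ F ∈ C, reiffenMetric D w X = reiffenMetric openUnitDisc (F w) (deriv F w * X)

/-- `D` is `c`-finitely compact: all Carathéodory balls are relatively compact in `D`. -/
def IsCFinitelyCompact (D : Set ℂ) : Prop :=
  ∀ w ∈ D, ∀ r : ℝ, 0 < r →
    IsCompact (closure {z ∈ D | caratheodoryDist D w z < ENNReal.ofReal r}) ∧
      closure {z ∈ D | caratheodoryDist D w z < ENNReal.ofReal r} ⊆ D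

/-- `D` and `E` are biholomorphic: there are mutually inverse holomorphic maps between them. -/
def IsBiholomorphic (D E : Set ℂ) : Prop :=
  ∃ f g : ℂ → ℂ, DifferentiableOn ℂ f D ∧ DifferentiableOn ℂ g E ∧
    MapsTo f D E ∧ MapsTo g E D ∧ InvOn g f D E

end

/-!
Call `F : D → 𝔻` extremal at `w` if `|F'(w)| / (1 - |F(w)|²)`, the density at `w` of the pulled back
hyperbolic metric, attains the supremum in the definition of `γ_D(w; 1)`. By the Schwarz–Pick lemma
`C` is a universal set exactly if each point of `D` has an extremal function in `C`
(`reiffenMetric_eq_iff_isExtremalAt`).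

*A single function suffices.* Functions that are extremal at a common point differ by an
automorphism of the disc (`eqOn_of_extremal`). Indeed, if `f` and `g` are bounded by `1`, vanish at
`w` and have the same maximal derivative there, then `h = (f + g) / 2` is extremal too, and
`‖h‖ + ‖(f - g)² / 8‖ ≤ 1`; if `f ≠ g`, then dividing `(f - g)² / 8` by a power of `z - w` gives a
perturbation of `h` with a larger derivative (`exists_norm_deriv_lt`). Hence such functions have the
same density on all of `D` (`IsExtremalAt.eqOn_hypDensity`). The sets of points at which the
members of `C` are extremal are therefore pairwise equal or disjoint. They are relatively closed,
finite in number, and cover `D`, so by connectedness one of them is `D`.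

*Finitely compact domains.* Let `F` be extremal everywhere. On a `c`-finitely compact domain `F` has
no critical points, since otherwise all bounded holomorphic functions would be constant and `D`
itself would be a relatively compact ball. So `F` is a local isometry from `γ_D` to the hyperbolic
metric, and a local inverse of `F` on a disc of radius `R < 1` about `0 = F(w)` is an infinitesimal
contraction for all maps `D → 𝔻`. It therefore takes its values in a Carathéodory ball that
depends on `R` only (`IsSectionOn.caratheodoryDist_lt`). As this ball is relatively compact, local
inverses can be continued by a fixed amount (`IsSectionOn.exists_extension`), and one obtains a
right inverse of `F` on the whole disc. By the identity theorem it is also a left inverse.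
-/

open Filter Topology

/-! ### Disc automorphisms -/

/-- The automorphism of the unit disc which sends `a` to the origin. -/
noncomputable def discAut (a z : ℂ) : ℂ := (z - a) / (1 - conj a * z)

lemma discAut_self (a : ℂ) : discAut a a = 0 := by simp [discAut]

lemma hypDist_eq (a b : ℂ) : hypDist a b = Real.artanh ‖discAut a b‖ := by
  have h : ‖1 - conj b * a‖ = ‖1 - conj a * b‖ := by
    rw [← Complex.norm_conj (1 - conj b * a)]
    simp [mul_comm]
  rw [hypDist, discAut, norm_div, norm_div, norm_sub_rev a b, h]

lemma one_sub_conj_mul_ne_zero {a z : ℂ} (ha : ‖a‖ < 1) (hz : ‖z‖ ≤ 1) :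
    1 - conj a * z ≠ 0 := by
  intro h
  have h1 : ‖conj a * z‖ = 1 := by rw [← sub_eq_zero.1 h, norm_one]
  rw [norm_mul, Complex.norm_conj] at h1
  nlinarith [norm_nonneg a, norm_nonneg z]

lemma one_sub_norm_discAut_sq {a z : ℂ} (ha : ‖a‖ < 1) (hz : ‖z‖ ≤ 1) :
    1 - ‖discAut a z‖ ^ 2 = (1 - ‖a‖ ^ 2) * (1 - ‖z‖ ^ 2) / ‖1 - conj a * z‖ ^ 2 := by
  have h0 : ‖1 - conj a * z‖ ^ 2 ≠ 0 :=
    pow_ne_zero _ (norm_ne_zero_iff.2 (one_sub_conj_mul_ne_zero ha hz))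
  rw [discAut, norm_div, div_pow, eq_div_iff h0, sub_mul, div_mul_cancel₀ _ h0]
  simp only [← Complex.normSq_eq_norm_sq, Complex.normSq_apply]
  simp
  ring

lemma norm_discAut_lt_one {a z : ℂ} (ha : ‖a‖ < 1) (hz : ‖z‖ < 1) : ‖discAut a z‖ < 1 := by
  have h := one_sub_norm_discAut_sq ha hz.le
  have h0 : 0 < ‖1 - conj a * z‖ := norm_pos_iff.2 (one_sub_conj_mul_ne_zero ha hz.le)
  have h1 : 0 < (1 - ‖a‖ ^ 2) * (1 - ‖z‖ ^ 2) / ‖1 - conj a * z‖ ^ 2 := by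
    have : 0 < 1 - ‖a‖ ^ 2 := by nlinarith [norm_nonneg a]
    have : 0 < 1 - ‖z‖ ^ 2 := by nlinarith [norm_nonneg z]
    positivity
  nlinarith [norm_nonneg (discAut a z)]

lemma hasDerivAt_discAut {a z : ℂ} (ha : ‖a‖ < 1) (hz : ‖z‖ ≤ 1) :
    HasDerivAt (discAut a) ((1 - conj a * a) / (1 - conj a * z) ^ 2) z := by
  have h0 := one_sub_conj_mul_ne_zero ha hz
  have h := ((hasDerivAt_id z).sub_const a).div
    (((hasDerivAt_id z).const_mul (conj a)).const_sub 1) h0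
  have e : (1 * (1 - conj a * id z) - (id z - a) * -(conj a * 1)) = 1 - conj a * a := by
    simp only [id]
    ring
  rwa [e] at h

lemma norm_one_sub_conj_mul_self {a : ℂ} (ha : ‖a‖ < 1) :
    ‖1 - conj a * a‖ = 1 - ‖a‖ ^ 2 := by
  rw [Complex.conj_mul', ← Complex.ofReal_pow, ← Complex.ofReal_one, ← Complex.ofReal_sub,
    Complex.norm_real, Real.norm_of_nonneg]
  nlinarith [norm_nonneg a]

/-! ### The pulled back hyperbolic density -/

lemma mem_openUnitDisc {z : ℂ} : z ∈ openUnitDisc ↔ ‖z‖ < 1 := mem_ball_zero_iff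

lemma norm_lt_one_of_mem {D : Set ℂ} {F : ℂ → ℂ} (hF : F ∈ holToDisc D) {z : ℂ} (hz : z ∈ D) :
    ‖F z‖ < 1 := mem_openUnitDisc.1 (hF.2 hz)

/-- The density at `w` of the pullback by `F` of the hyperbolic metric of the unit disc. -/
noncomputable def hypDensity (F : ℂ → ℂ) (w : ℂ) : ℝ := ‖deriv F w‖ / (1 - ‖F w‖ ^ 2)

variable {D : Set ℂ} {F G : ℂ → ℂ} {a w : ℂ}

lemma hypDensity_of_eq_zero (h : F w = 0) : hypDensity F w = ‖deriv F w‖ := by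
  simp [hypDensity, h]

lemma hypDensity_congr (hD : IsOpen D) (hw : w ∈ D) (h : EqOn F G D) :
    hypDensity F w = hypDensity G w := by
  have : F =ᶠ[𝓝 w] G := h.eventuallyEq_of_mem (hD.mem_nhds hw)
  rw [hypDensity, hypDensity, this.deriv_eq, h hw]

lemma discAut_comp_mem (ha : ‖a‖ < 1) (hF : F ∈ holToDisc D) :
    (fun z => discAut a (F z)) ∈ holToDisc D := by
  refine ⟨fun z hz => ?_, fun z hz =>
    mem_openUnitDisc.2 (norm_discAut_lt_one ha (norm_lt_one_of_mem hF hz))⟩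
  exact (hasDerivAt_discAut ha (norm_lt_one_of_mem hF
    hz).le).differentiableAt.comp_differentiableWithinAt z (hF.1 z hz)

/-- The density is invariant under disc automorphisms. -/
lemma hypDensity_discAut_comp (hD : IsOpen D) (ha : ‖a‖ < 1) (hF : F ∈ holToDisc D)
    (hw : w ∈ D) : hypDensity (fun z => discAut a (F z)) w = hypDensity F w := by
  have hFw := norm_lt_one_of_mem hF hw
  have hd : HasDerivAt (fun z => discAut a (F z))
      ((1 - conj a * a) / (1 - conj a * F w) ^ 2 * deriv F w) w :=
    (hasDerivAt_discAut ha hFw.le).comp w (hF.1.differentiableAt (hD.mem_nhds hw)).hasDerivAt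
  have h0 : ‖1 - conj a * F w‖ ≠ 0 := norm_ne_zero_iff.2 (one_sub_conj_mul_ne_zero ha hFw.le)
  have h1 : 1 - ‖a‖ ^ 2 ≠ 0 := by nlinarith [norm_nonneg a]
  have h2 : 1 - ‖F w‖ ^ 2 ≠ 0 := by nlinarith [norm_nonneg (F w)]
  rw [hypDensity, hypDensity, hd.deriv, one_sub_norm_discAut_sq ha hFw.le, norm_mul, norm_div,
    norm_pow, norm_one_sub_conj_mul_self ha]
  field_simp

lemma norm_deriv_discAut_comp_self (hD : IsOpen D) (hF : F ∈ holToDisc D) (hw : w ∈ D) :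
    ‖deriv (fun z => discAut (F w) (F z)) w‖ = hypDensity F w := by
  rw [← hypDensity_discAut_comp hD (norm_lt_one_of_mem hF hw) hF hw,
    hypDensity_of_eq_zero (F := fun z => discAut (F w) (F z)) (discAut_self (F w))]

lemma continuousOn_hypDensity (hD : IsOpen D) (hF : F ∈ holToDisc D) :
    ContinuousOn (hypDensity F) D := by
  refine (hF.1.deriv hD).continuousOn.norm.div
    (continuousOn_const.sub (hF.1.continuousOn.norm.pow 2)) fun z hz => ?_
  nlinarith [norm_nonneg (F z), norm_lt_one_of_mem hF hz]

/-! ### Extremality at a point -/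

/-- `F` solves the infinitesimal Carathéodory extremal problem at `w`: no holomorphic function
which is bounded by `1` and vanishes at `w` has a derivative at `w` exceeding the density of `F`.
The direction `X` plays no role in dimension one. -/
def IsExtremalAt (D : Set ℂ) (F : ℂ → ℂ) (w : ℂ) : Prop :=
  ∀ G : ℂ → ℂ, DifferentiableOn ℂ G D → (∀ z ∈ D, ‖G z‖ ≤ 1) → G w = 0 →
    ‖deriv G w‖ ≤ hypDensity F w

lemma IsExtremalAt.hypDensity_le (hD : IsOpen D) (hw : w ∈ D) (hF : IsExtremalAt D F w)
    (hG : G ∈ holToDisc D) : hypDensity G w ≤ hypDensity F w := by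
  have h := discAut_comp_mem (norm_lt_one_of_mem hG hw) hG
  rw [← norm_deriv_discAut_comp_self hD hG hw]
  exact hF _ h.1 (fun z hz => (norm_lt_one_of_mem h hz).le) (discAut_self _)

lemma IsExtremalAt.mono (hF : IsExtremalAt D F w) (h : hypDensity F w ≤ hypDensity G w) :
    IsExtremalAt D G w :=
  fun H h1 h2 h3 => (hF H h1 h2 h3).trans h

lemma ofReal_hypDensity_mul_le_reiffenMetric (hD : IsOpen D) (hw : w ∈ D) (hF : F ∈ holToDisc D)
    (X : ℂ) : ENNReal.ofReal (hypDensity F w * ‖X‖) ≤ reiffenMetric D w X := by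
  have h := discAut_comp_mem (norm_lt_one_of_mem hF hw) hF
  rw [← norm_deriv_discAut_comp_self hD hF hw, ← norm_mul]
  exact le_iSup₂_of_le (fun z => discAut (F w) (F z))
    ⟨h.1, fun z hz => (norm_lt_one_of_mem h hz).le, discAut_self _⟩ le_rfl

lemma isOpen_openUnitDisc : IsOpen openUnitDisc := isOpen_ball

/-- The Schwarz–Pick lemma at a zero of the function. -/
lemma norm_deriv_le_of_mem_disc (ha : ‖a‖ < 1) (hF : DifferentiableOn ℂ F openUnitDisc)
    (hF1 : ∀ z ∈ openUnitDisc, ‖F z‖ ≤ 1) (h0 : F a = 0) : ‖deriv F a‖ ≤ 1 / (1 - ‖a‖ ^ 2) := by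
  have ha' : ‖-a‖ < 1 := by rwa [norm_neg]
  have e0 : discAut (-a) 0 = a := by simp [discAut]
  have hm : ∀ z ∈ ball (0 : ℂ) 1, discAut (-a) z ∈ openUnitDisc := fun z hz =>
    mem_openUnitDisc.2 (norm_discAut_lt_one ha' (mem_ball_zero_iff.1 hz))
  have hdf : DifferentiableOn ℂ (F ∘ discAut (-a)) (ball 0 1) :=
    hF.comp (fun z hz => (hasDerivAt_discAut ha'
      (mem_ball_zero_iff.1 hz).le).differentiableAt.differentiableWithinAt) hm
  have hs := Complex.norm_deriv_le_one_of_mapsTo_ball hdf (fun z hz => by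
    simpa [e0, h0] using hF1 _ (hm z hz)) one_pos
  have hFa : HasDerivAt F (deriv F a) (discAut (-a) 0) := by
    rw [e0]
    exact (hF.differentiableAt (isOpen_openUnitDisc.mem_nhds (mem_openUnitDisc.2 ha))).hasDerivAt
  rw [(hFa.comp 0 (hasDerivAt_discAut ha' (by simp))).deriv] at hs
  have e1 := norm_one_sub_conj_mul_self ha
  have h1 : 0 < 1 - ‖a‖ ^ 2 := by nlinarith [norm_nonneg a]
  simp only [map_neg, neg_mul_neg, mul_zero, sub_zero, one_pow, div_one, norm_mul, e1] at hs
  rwa [le_div_iff₀ h1]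

lemma reiffenMetric_openUnitDisc (ha : ‖a‖ < 1) (X : ℂ) :
    reiffenMetric openUnitDisc a X = ENNReal.ofReal (‖X‖ / (1 - ‖a‖ ^ 2)) := by
  apply le_antisymm
  · refine iSup₂_le fun F hF => ENNReal.ofReal_le_ofReal ?_
    rw [norm_mul, div_eq_inv_mul, ← one_div]
    exact mul_le_mul_of_nonneg_right (norm_deriv_le_of_mem_disc ha hF.1 hF.2.1 hF.2.2)
      (norm_nonneg _)
  · have h := ofReal_hypDensity_mul_le_reiffenMetric (F := id) isOpen_openUnitDisc
      (mem_openUnitDisc.2 ha) ⟨differentiableOn_id, mapsTo_id _⟩ X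
    rwa [hypDensity, deriv_id', norm_one, id, div_mul_eq_mul_div, one_mul] at h

lemma hypDensity_nonneg (hF : F ∈ holToDisc D) (hw : w ∈ D) : 0 ≤ hypDensity F w :=
  div_nonneg (norm_nonneg _) (by nlinarith [norm_nonneg (F w), norm_lt_one_of_mem hF hw])

lemma reiffenMetric_eq_iff_isExtremalAt (hD : IsOpen D) (hw : w ∈ D) (hF : F ∈ holToDisc D)
    {X : ℂ} (hX : X ≠ 0) :
    reiffenMetric D w X = reiffenMetric openUnitDisc (F w) (deriv F w * X) ↔
      IsExtremalAt D F w := by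
  have hX0 : 0 < ‖X‖ := norm_pos_iff.2 hX
  rw [reiffenMetric_openUnitDisc (norm_lt_one_of_mem hF hw), norm_mul, mul_div_right_comm,
    ← hypDensity]
  constructor
  · intro h G h1 h2 h3
    have hle : ENNReal.ofReal ‖deriv G w * X‖ ≤ reiffenMetric D w X :=
      le_iSup₂_of_le G ⟨h1, h2, h3⟩ le_rfl
    rw [h, ENNReal.ofReal_le_ofReal_iff (mul_nonneg (hypDensity_nonneg hF hw) hX0.le),
      norm_mul] at hle
    exact le_of_mul_le_mul_right hle hX0
  · intro h
    refine le_antisymm (iSup₂_le fun G hG => ENNReal.ofReal_le_ofReal ?_)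
      (ofReal_hypDensity_mul_le_reiffenMetric hD hw hF X)
    rw [norm_mul]
    exact mul_le_mul_of_nonneg_right (h G hG.1 hG.2.1 hG.2.2) hX0.le

lemma isInfinitesimalUniversalSet_singleton_iff (hD : IsOpen D) :
    IsInfinitesimalUniversalSet D {F} ↔ F ∈ holToDisc D ∧ ∀ w ∈ D, IsExtremalAt D F w := by
  simp only [IsInfinitesimalUniversalSet, singleton_subset_iff, mem_singleton_iff,
    exists_eq_left]
  refine and_congr_right fun hF => forall₂_congr fun w hw => ⟨fun h => ?_, fun h X hX => ?_⟩
  · exact (reiffenMetric_eq_iff_isExtremalAt hD hw hF one_ne_zero).1 (h 1 one_ne_zero)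
  · exact (reiffenMetric_eq_iff_isExtremalAt hD hw hF hX).2 h

/-! ### Uniqueness of the extremal functions -/

/-- A holomorphic function `f ≢ 0` vanishing at `w` equals `(z - w) ^ m * q z` with a function `q`
that has a simple zero at `w`. -/
lemma exists_pow_mul_simple_zero (hD : IsOpen D) (hDc : IsPreconnected D)
    {f : ℂ → ℂ} (hf : DifferentiableOn ℂ f D) (hw : w ∈ D) (hfw : f w = 0)
    (hne : ∃ z ∈ D, f z ≠ 0) :
    ∃ (m : ℕ) (q : ℂ → ℂ), DifferentiableOn ℂ q D ∧ q w = 0 ∧ deriv q w ≠ 0 ∧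
      ∀ z ∈ D, z ≠ w → q z = f z / (z - w) ^ m := by
  have hfa : AnalyticAt ℂ f w := hf.analyticAt (hD.mem_nhds hw)
  have hnz : ¬∀ᶠ z in 𝓝 w, f z = 0 := by
    intro h
    obtain ⟨z, hz, hfz⟩ := hne
    exact hfz ((hf.analyticOnNhd hD).eqOn_zero_of_preconnected_of_eventuallyEq_zero hDc hw h hz)
  obtain ⟨n, g, hga, hgw, hfg⟩ := hfa.exists_eventuallyEq_pow_smul_nonzero_iff.2 hnz
  obtain ⟨m, rfl⟩ : ∃ m, n = m + 1 := by
    refine Nat.exists_eq_succ_of_ne_zero ?_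
    rintro rfl
    have := hfg.self_of_nhds
    rw [hfw] at this
    simp [eq_comm, hgw] at this
  -- at `w` the quotient has the value `0`, as `f w = 0`; this is the correct value
  refine ⟨m, fun z => f z / (z - w) ^ m, ?_⟩
  have hloc : (fun z => f z / (z - w) ^ m) =ᶠ[𝓝 w] fun z => (z - w) * g z := by
    filter_upwards [hfg] with z hz
    rcases eq_or_ne z w with rfl | hzw
    · simp [hfw]
    · have : z - w ≠ 0 := sub_ne_zero.2 hzw
      rw [hz, smul_eq_mul, div_eq_iff (pow_ne_zero _ this)]
      ring
  have hder : HasDerivAt (fun z => (z - w) * g z) (g w) w := by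
    simpa using ((hasDerivAt_id w).sub_const w).fun_mul hga.differentiableAt.hasDerivAt
  refine ⟨fun z hz => ?_, by simp [hfw], by rwa [hloc.deriv_eq, hder.deriv], fun _ _ _ => rfl⟩
  rcases eq_or_ne z w with rfl | hzw
  · exact (hloc.differentiableAt_iff.2 hder.differentiableAt).differentiableWithinAt
  · exact (hf z hz).div (by fun_prop) (pow_ne_zero _ (sub_ne_zero.2 hzw))

/-- If `‖h‖ + ‖f‖ ≤ 1` with `f ≢ 0`, then `h` is not extremal: adding to `h` a small multiple of
`f z / (z - w) ^ m`, where `m + 1` is the order of the zero of `f` at `w`, increases the derivative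
at `w`. The bound by `1` holds away from `w`, and near `w` by the maximum principle. -/
lemma exists_norm_deriv_lt (hD : IsOpen D) (hDc : IsPreconnected D) {h f : ℂ → ℂ}
    (hh : DifferentiableOn ℂ h D) (hf : DifferentiableOn ℂ f D) (hw : w ∈ D)
    (hhw : h w = 0) (hfw : f w = 0) (hle : ∀ z ∈ D, ‖h z‖ + ‖f z‖ ≤ 1)
    (hne : ∃ z ∈ D, f z ≠ 0) :
    ∃ H : ℂ → ℂ, DifferentiableOn ℂ H D ∧ (∀ z ∈ D, ‖H z‖ ≤ 1) ∧ H w = 0 ∧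
      ‖deriv h w‖ < ‖deriv H w‖ := by
  obtain ⟨m, q, hq, hqw, hq', hqf⟩ := exists_pow_mul_simple_zero hD hDc hf hw hfw hne
  obtain ⟨R, hR, hRD⟩ := nhds_basis_closedBall.mem_iff.1 (hD.mem_nhds hw)
  -- the phase that aligns the two derivatives
  obtain ⟨u, hu, hu'⟩ : ∃ u : ℂ, ‖u‖ = 1 ∧
      ‖deriv h w + (R ^ m : ℝ) * (u * deriv q w)‖ = ‖deriv h w‖ + R ^ m * ‖deriv q w‖ := by
    have key : ∀ x y : ℂ, ‖x‖ = 1 → ‖y‖ = 1 → ∀ s t : ℝ, 0 ≤ s → 0 ≤ t →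
        ‖(s : ℂ) * x + (R ^ m : ℝ) * (x / y * (t * y))‖ = s + R ^ m * t := by
      intro x y hx hy s t hs ht
      have hy0 : y ≠ 0 := norm_ne_zero_iff.1 (by rw [hy]; exact one_ne_zero)
      have : (s : ℂ) * x + (R ^ m : ℝ) * (x / y * (t * y)) = ((s + R ^ m * t : ℝ) : ℂ) * x := by
        push_cast
        field_simp
      rw [this, norm_mul, hx, mul_one, Complex.norm_real, Real.norm_of_nonneg (by positivity)]
    have polar : ∀ x : ℂ, ∃ v : ℂ, ‖v‖ = 1 ∧ (‖x‖ : ℂ) * v = x := fun x =>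
      ⟨exp (x.arg * I), Complex.norm_exp_ofReal_mul_I _, Complex.norm_mul_exp_arg_mul_I x⟩
    obtain ⟨x, hx, hx'⟩ := polar (deriv h w)
    obtain ⟨y, hy, hy'⟩ := polar (deriv q w)
    refine ⟨x / y, by rw [norm_div, hx, hy, div_one], ?_⟩
    have := key x y hx hy _ _ (norm_nonneg (deriv h w)) (norm_nonneg (deriv q w))
    rwa [hx', hy'] at this
  have hH : DifferentiableOn ℂ (fun z => h z + (R ^ m : ℝ) * (u * q z)) D :=
    hh.add ((hq.const_mul u).const_mul _)
  have hout : ∀ z ∈ D, R ≤ dist z w → ‖h z + (R ^ m : ℝ) * (u * q z)‖ ≤ 1 := by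
    intro z hz hzR
    have hzw : z ≠ w := dist_pos.1 (hR.trans_le hzR)
    refine (norm_add_le _ _).trans ((add_le_add_right ?_ _).trans (hle z hz))
    rw [norm_mul, norm_mul, hu, one_mul, Complex.norm_real, Real.norm_of_nonneg (by positivity),
      hqf z hz hzw, norm_div, norm_pow, ← dist_eq_norm, mul_div_left_comm]
    refine mul_le_of_le_one_right (norm_nonneg _) ?_
    exact div_le_one_of_le₀ (pow_le_pow_left₀ hR.le hzR m) (by positivity)
  refine ⟨_, hH, fun z hz => ?_, by simp [hhw, hqw], ?_⟩
  · rcases le_or_gt R (dist z w) with hzR | hzR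
    · exact hout z hz hzR
    · refine Complex.norm_le_of_forall_mem_frontier_norm_le
        (f := fun z => h z + (R ^ m : ℝ) * (u * q z)) (U := ball w R) isBounded_ball ?_ ?_
        (subset_closure (mem_ball.2 hzR))
      · exact DifferentiableOn.diffContOnCl_ball hH hRD
      · intro y hy
        rw [frontier_ball w hR.ne'] at hy
        exact hout y (hRD (sphere_subset_closedBall hy)) (mem_sphere.1 hy).ge
  · have hda := (hh.differentiableAt (hD.mem_nhds hw)).hasDerivAt
    have hdq := (hq.differentiableAt (hD.mem_nhds hw)).hasDerivAt
    rw [(hda.fun_add ((hdq.const_mul u).const_mul _)).deriv, hu']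
    have : 0 < R ^ m * ‖deriv q w‖ := mul_pos (pow_pos hR m) (norm_pos_iff.2 hq')
    linarith

/-- Two functions bounded by `1` that vanish at `w` and have the same derivative of maximal
modulus there coincide. -/
lemma eqOn_of_extremal (hD : IsOpen D) (hDc : IsPreconnected D) {f g : ℂ → ℂ}
    (hf : DifferentiableOn ℂ f D) (hg : DifferentiableOn ℂ g D)
    (hf1 : ∀ z ∈ D, ‖f z‖ ≤ 1) (hg1 : ∀ z ∈ D, ‖g z‖ ≤ 1) (hw : w ∈ D)
    (hfw : f w = 0) (hgw : g w = 0) (hfg : deriv f w = deriv g w)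
    (hmax : ∀ H : ℂ → ℂ, DifferentiableOn ℂ H D → (∀ z ∈ D, ‖H z‖ ≤ 1) → H w = 0 →
      ‖deriv H w‖ ≤ ‖deriv f w‖) : EqOn f g D := by
  by_contra hne
  obtain ⟨z₀, hz₀, hz₀'⟩ : ∃ z ∈ D, f z ≠ g z := by simpa [EqOn] using hne
  have hd : DifferentiableOn ℂ (fun z => (f z + g z) / 2) D := (hf.add hg).div_const 2
  have hle : ∀ z ∈ D, ‖(f z + g z) / 2‖ + ‖((f z - g z) / 2) ^ 2 / 2‖ ≤ 1 := by
    intro z hz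
    -- the parallelogram law bounds `‖(f + g) / 2‖ ^ 2 + ‖(f - g) / 2‖ ^ 2` by `1`
    have hp := parallelogram_law_with_norm ℝ (f z) (g z)
    have h1 := hf1 z hz
    have h2 := hg1 z hz
    simp only [norm_div, norm_pow, Complex.norm_ofNat]
    nlinarith [norm_nonneg (f z), norm_nonneg (g z), sq_nonneg (‖f z + g z‖ / 2 - 1)]
  obtain ⟨H, h1, h2, h3, h4⟩ := exists_norm_deriv_lt hD hDc (w := w)
    (h := fun z => (f z + g z) / 2) (f := fun z => ((f z - g z) / 2) ^ 2 / 2) hd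
    ((((hf.sub hg).div_const 2).pow 2).div_const 2) hw (by simp [hfw, hgw]) (by simp [hfw, hgw])
    hle ⟨z₀, hz₀, by simpa [sub_eq_zero] using hz₀'⟩
  have hda := ((hf.differentiableAt (hD.mem_nhds hw)).hasDerivAt.add
    (hg.differentiableAt (hD.mem_nhds hw)).hasDerivAt).div_const 2
  have e : deriv (fun z => (f z + g z) / 2) w = deriv f w := by
    refine hda.deriv.trans ?_
    rw [← hfg]
    ring
  rw [e] at h4
  exact (hmax H h1 h2 h3).not_gt h4

/-- Uniqueness of the extremal functions: if `F` and `G` are extremal at one common point, then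
they differ by an automorphism of the disc, and hence their densities agree everywhere. -/
lemma IsExtremalAt.eqOn_hypDensity (hD : IsOpen D) (hDc : IsPreconnected D)
    (hF : F ∈ holToDisc D) (hG : G ∈ holToDisc D) (hw : w ∈ D)
    (hFw : IsExtremalAt D F w) (hGw : IsExtremalAt D G w) :
    EqOn (hypDensity F) (hypDensity G) D := by
  have heq : hypDensity F w = hypDensity G w :=
    le_antisymm (hGw.hypDensity_le hD hw hF) (hFw.hypDensity_le hD hw hG)
  have hf := discAut_comp_mem (norm_lt_one_of_mem hF hw) hF
  have hg := discAut_comp_mem (norm_lt_one_of_mem hG hw) hG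
  have hf' := norm_deriv_discAut_comp_self hD hF hw
  have hg' := norm_deriv_discAut_comp_self hD hG hw
  set f := fun z => discAut (F w) (F z) with hfdef
  set g := fun z => discAut (G w) (G z) with hgdef
  obtain ⟨u, hu, hu'⟩ : ∃ u : ℂ, ‖u‖ = 1 ∧ deriv f w = u * deriv g w := by
    by_cases h0 : deriv g w = 0
    · refine ⟨1, norm_one, ?_⟩
      rw [h0, mul_zero, ← norm_eq_zero, hf', heq, ← hg', h0, norm_zero]
    · refine ⟨deriv f w / deriv g w, ?_, (div_mul_cancel₀ _ h0).symm⟩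
      rw [norm_div, hf', heq, ← hg', div_self (norm_ne_zero_iff.2 h0)]
  have hgu : ∀ z ∈ D, HasDerivAt (fun z => u * g z) (u * deriv g z) z := fun z hz =>
    (hg.1.differentiableAt (hD.mem_nhds hz)).hasDerivAt.const_mul u
  have key : EqOn f (fun z => u * g z) D := by
    refine eqOn_of_extremal hD hDc (w := w) hf.1 (hg.1.const_mul u)
      (fun z hz => (norm_lt_one_of_mem hf hz).le)
      (fun z hz => by rw [norm_mul, hu, one_mul]; exact (norm_lt_one_of_mem hg hz).le) hw
      (discAut_self _) ?_ ?_ ?_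
    · simp [hgdef, discAut_self]
    · rw [hu', (hgu w hw).deriv]
    · rw [hf']
      exact hFw
  intro z hz
  rw [← hypDensity_discAut_comp hD (norm_lt_one_of_mem hF hw) hF hz,
    ← hypDensity_discAut_comp hD (norm_lt_one_of_mem hG hw) hG hz, ← hfdef, ← hgdef,
    hypDensity_congr hD hz key, hypDensity, (hgu z hz).deriv, norm_mul, norm_mul, hu, one_mul,
    one_mul, hypDensity]

/-! ### Reduction to a single function -/

/-- A finite universal set contains a function that is extremal at all points. -/
lemma exists_forall_isExtremalAt (hD : IsPlanarDomain D) {C : Set (ℂ → ℂ)} (hC : C.Finite)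
    (hCu : IsInfinitesimalUniversalSet D C) :
    ∃ F ∈ holToDisc D, ∀ w ∈ D, IsExtremalAt D F w := by
  obtain ⟨hDo, ⟨w₀, hw₀⟩, hDc⟩ := hD
  have hex : ∀ w ∈ D, ∃ F ∈ C, IsExtremalAt D F w := fun w hw => by
    obtain ⟨F, hF, h⟩ := hCu.2 w hw 1 one_ne_zero
    exact ⟨F, hF, (reiffenMetric_eq_iff_isExtremalAt hDo hw (hCu.1 hF) one_ne_zero).1 h⟩
  -- where `F` is not extremal, some `G` in `C` is strictly better, also at all nearby points
  have hopen : ∀ F ∈ C, ∀ w ∈ D, ¬IsExtremalAt D F w → ∀ᶠ z in 𝓝 w, ¬IsExtremalAt D F z := by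
    intro F hF w hw hn
    obtain ⟨G, hG, hGw⟩ := hex w hw
    have hlt : hypDensity F w < hypDensity G w := not_le.1 fun h => hn (hGw.mono h)
    have hcF := (continuousOn_hypDensity hDo (hCu.1 hF)).continuousAt (hDo.mem_nhds hw)
    have hcG := (continuousOn_hypDensity hDo (hCu.1 hG)).continuousAt (hDo.mem_nhds hw)
    filter_upwards [hcF.eventually_lt hcG hlt, hDo.mem_nhds hw] with z hz hzD hzF
    exact (hzF.hypDensity_le hDo hzD (hCu.1 hG)).not_gt hz
  obtain ⟨F, hF, hFw₀⟩ := hex w₀ hw₀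
  refine ⟨F, hCu.1 hF, ?_⟩
  -- the points at which `F` is extremal form a relatively clopen subset of `D`
  have hU : IsOpen {z | z ∈ D ∧ IsExtremalAt D F z} := by
    refine isOpen_iff_mem_nhds.2 fun w hw => ?_
    have hall : ∀ᶠ z in 𝓝 w, ∀ G ∈ C, IsExtremalAt D G z → IsExtremalAt D G w := by
      refine (eventually_all_finite hC).2 fun G hG => ?_
      by_cases hGw : IsExtremalAt D G w
      · exact Eventually.of_forall fun _ _ => hGw
      · filter_upwards [hopen G hG w hw.1 hGw] with z hz h
        exact absurd h hz
    filter_upwards [hall, hDo.mem_nhds hw.1] with z hz hzD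
    obtain ⟨G, hG, hGz⟩ := hex z hzD
    refine ⟨hzD, hGz.mono (le_of_eq ?_)⟩
    exact hw.2.eqOn_hypDensity hDo hDc (hCu.1 hF) (hCu.1 hG) hw.1 (hz G hG hGz) hzD |>.symm
  have hV : IsOpen {z | z ∈ D ∧ ¬IsExtremalAt D F z} := by
    refine isOpen_iff_mem_nhds.2 fun w hw => ?_
    filter_upwards [hopen F hF w hw.1 hw.2, hDo.mem_nhds hw.1] with z hz hzD
    exact ⟨hzD, hz⟩
  have hsub := hDc.subset_left_of_subset_union hU hV
    (disjoint_left.2 fun z h1 h2 => h2.2 h1.2)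
    (fun z hz => (em (IsExtremalAt D F z)).imp (fun h => ⟨hz, h⟩) fun h => ⟨hz, h⟩)
    ⟨w₀, hw₀, hw₀, hFw₀⟩
  exact fun w hw => (hsub hw).2


/-! ### Holomorphic sections -/

/-- `g` is a holomorphic section over `U` of the map `F` on `D`. -/
def IsSectionOn (D : Set ℂ) (F g : ℂ → ℂ) (U : Set ℂ) : Prop :=
  DifferentiableOn ℂ g U ∧ MapsTo g U D ∧ ∀ z ∈ U, F (g z) = z

lemma IsSectionOn.mono {g : ℂ → ℂ} {U V : Set ℂ} (h : IsSectionOn D F g U) (hVU : V ⊆ U) :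
    IsSectionOn D F g V :=
  ⟨h.1.mono hVU, h.2.1.mono_left hVU, fun z hz => h.2.2 z (hVU hz)⟩

lemma exists_eventually_left_inverse (hD : IsOpen D) (hF : DifferentiableOn ℂ F D)
    (hw : w ∈ D) (hF' : deriv F w ≠ 0) : ∃ s : ℂ → ℂ, ∀ᶠ z in 𝓝 w, s (F z) = z :=
  ⟨_, ((hF.analyticAt (hD.mem_nhds hw)).hasStrictDerivAt.hasStrictFDerivAt_equiv
    hF').eventually_left_inverse⟩

lemma IsSectionOn.eqOn {g₁ g₂ : ℂ → ℂ} {U : Set ℂ} (hD : IsOpen D) (hF : DifferentiableOn ℂ F D)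
    (hF' : ∀ z ∈ D, deriv F z ≠ 0) (hU : IsOpen U) (hUc : IsPreconnected U)
    (h₁ : IsSectionOn D F g₁ U) (h₂ : IsSectionOn D F g₂ U) {z : ℂ} (hz : z ∈ U)
    (heq : g₁ z = g₂ z) : EqOn g₁ g₂ U := by
  obtain ⟨s, hs⟩ := exists_eventually_left_inverse hD hF (h₁.2.1 hz) (hF' _ (h₁.2.1 hz))
  have hUz := hU.mem_nhds hz
  refine (h₁.1.analyticOnNhd hU).eqOn_of_preconnected_of_eventuallyEq (h₂.1.analyticOnNhd hU)
    hUc hz ?_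
  have hs₂ := hs
  rw [heq] at hs₂
  filter_upwards [(h₁.1.continuousOn.continuousAt hUz).eventually hs,
    (h₂.1.continuousOn.continuousAt hUz).eventually hs₂, hUz] with y e₁ e₂ hy
  rw [← e₁, ← e₂, h₁.2.2 y hy, h₂.2.2 y hy]

/-- Near a non-critical point there are sections over discs of a fixed radius. -/
lemma exists_section_nhds (hD : IsOpen D) (hF : DifferentiableOn ℂ F D)
    (hF' : ∀ z ∈ D, deriv F z ≠ 0) (hw : w ∈ D) :
    ∃ η > 0, ∀ᶠ q in 𝓝 w, ∃ s, IsSectionOn D F s (ball (F q) η) ∧ s (F q) = q := by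
  have hst := ((hF.analyticAt (hD.mem_nhds hw)).hasStrictDerivAt.hasStrictFDerivAt_equiv
    (hF' w hw))
  set e := hst.toOpenPartialHomeomorph F with he
  have hwe : w ∈ e.source := hst.mem_toOpenPartialHomeomorph_source
  have hee : ∀ z, e z = F z := fun z => rfl
  have hT : IsOpen (e.target ∩ e.symm ⁻¹' D) := e.isOpen_inter_preimage_symm hD
  have hwT : F w ∈ e.target ∩ e.symm ⁻¹' D := by
    refine ⟨e.map_source hwe, ?_⟩
    rw [mem_preimage, ← hee, e.left_inv hwe]
    exact hw
  obtain ⟨ε, hε, hεT⟩ := isOpen_iff.1 hT _ hwT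
  have hsec : IsSectionOn D F e.symm (e.target ∩ e.symm ⁻¹' D) := by
    refine ⟨fun y hy => ?_, fun y hy => hy.2, fun y hy => e.right_inv hy.1⟩
    refine (HasDerivAt.of_local_left_inverse (f := F) ((e.continuousOn_symm.continuousAt
      (e.open_target.mem_nhds hy.1))) (hF.differentiableAt (hD.mem_nhds hy.2)).hasDerivAt
      (hF' _ hy.2) ?_).differentiableAt.differentiableWithinAt
    filter_upwards [e.open_target.mem_nhds hy.1] with x hx using e.right_inv hx
  refine ⟨ε / 2, half_pos hε, ?_⟩
  have hc : ContinuousAt F w := (hF.differentiableAt (hD.mem_nhds hw)).continuousAt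
  filter_upwards [e.open_source.mem_nhds hwe, hc.eventually (ball_mem_nhds _ (half_pos hε))]
    with q hq hqε
  refine ⟨e.symm, hsec.mono (Subset.trans (ball_subset_ball' ?_) hεT), e.left_inv hq⟩
  linarith [mem_ball.1 hqε]

lemma exists_section_of_isCompact (hD : IsOpen D) (hF : DifferentiableOn ℂ F D)
    (hF' : ∀ z ∈ D, deriv F z ≠ 0) {K : Set ℂ} (hK : IsCompact K) (hKD : K ⊆ D) :
    ∃ η > 0, ∀ q ∈ K, ∃ s, IsSectionOn D F s (ball (F q) η) ∧ s (F q) = q := by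
  refine hK.induction_on (p := fun S => ∃ η > 0, ∀ q ∈ S,
    ∃ s, IsSectionOn D F s (ball (F q) η) ∧ s (F q) = q) ⟨1, one_pos, by simp⟩ ?_ ?_ ?_
  · rintro S T hST ⟨η, hη, h⟩
    exact ⟨η, hη, fun q hq => h q (hST hq)⟩
  · rintro S T ⟨η, hη, h⟩ ⟨η', hη', h'⟩
    refine ⟨min η η', lt_min hη hη', ?_⟩
    rintro q (hq | hq)
    · obtain ⟨s, hs, hsq⟩ := h q hq
      exact ⟨s, hs.mono (ball_subset_ball (min_le_left _ _)), hsq⟩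
    · obtain ⟨s, hs, hsq⟩ := h' q hq
      exact ⟨s, hs.mono (ball_subset_ball (min_le_right _ _)), hsq⟩
  · intro w hw
    obtain ⟨η, hη, h⟩ := exists_section_nhds hD hF hF' (hKD hw)
    exact ⟨_, mem_nhdsWithin_of_mem_nhds h, η, hη, fun q hq => hq⟩

/-- Gluing: a family of local sections that agree locally along the diagonal defines a section. -/
lemma isSectionOn_diagonal {V : Set ℂ} {U : ℂ → Set ℂ} {s : ℂ → ℂ → ℂ}
    (hU : ∀ z ∈ V, IsOpen (U z)) (hzU : ∀ z ∈ V, z ∈ U z)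
    (hs : ∀ z ∈ V, IsSectionOn D F (s z) (U z))
    (hloc : ∀ z ∈ V, ∀ᶠ y in 𝓝 z, s y y = s z y) : IsSectionOn D F (fun z => s z z) V := by
  refine ⟨fun z hz => ?_, fun z hz => (hs z hz).2.1 (hzU z hz),
    fun z hz => (hs z hz).2.2 z (hzU z hz)⟩
  have h : DifferentiableAt ℂ (s z) z :=
    (hs z hz).1.differentiableAt ((hU z hz).mem_nhds (hzU z hz))
  have hev : (fun y => s y y) =ᶠ[𝓝 z] s z := hloc z hz
  exact (hev.differentiableAt_iff.2 h).differentiableWithinAt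

/-- If `F` has sections over discs of radius `η` through all points of a section over a disc
about the origin, then this section extends to a disc whose radius is larger by `η / 2`. -/
lemma IsSectionOn.exists_extension (hD : IsOpen D) (hF : DifferentiableOn ℂ F D)
    (hF' : ∀ z ∈ D, deriv F z ≠ 0) {g : ℂ → ℂ} {R η : ℝ} (hR : 0 < R) (hη : 0 < η)
    (hg : IsSectionOn D F g (ball 0 R))
    (hext : ∀ z ∈ ball (0 : ℂ) R, ∃ s, IsSectionOn D F s (ball z η) ∧ s z = g z) :
    ∃ g', IsSectionOn D F g' (ball 0 (R + η / 2)) ∧ g' 0 = g 0 := by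
  choose! s hs hsg using hext
  -- continue from `t * z`, where `t < 1` is such that `t * z` ranges over the smaller disc
  set t : ℝ := R / (R + η / 2) with ht
  have ht0 : 0 < t := by positivity
  have htR : ∀ z ∈ ball (0 : ℂ) (R + η / 2), (t : ℂ) * z ∈ ball (0 : ℂ) R := by
    intro z hz
    rw [mem_ball_zero_iff] at hz ⊢
    rw [norm_mul, Complex.norm_real, Real.norm_of_nonneg ht0.le, ht, div_mul_eq_mul_div,
      div_lt_iff₀ (by positivity)]
    exact mul_lt_mul_of_pos_left hz hR
  have htη : ∀ z ∈ ball (0 : ℂ) (R + η / 2), z ∈ ball ((t : ℂ) * z) η := by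
    intro z hz
    rw [mem_ball_zero_iff] at hz
    have e : z - (t : ℂ) * z = ((1 - t : ℝ) : ℂ) * z := by
      push_cast
      ring
    have e' : 1 - t = η / 2 / (R + η / 2) := by
      rw [ht]
      field_simp
      ring
    rw [mem_ball, dist_eq_norm, e, norm_mul, Complex.norm_real, e',
      Real.norm_of_nonneg (by positivity), div_mul_eq_mul_div, div_lt_iff₀ (by positivity)]
    nlinarith
  -- two sections over overlapping discs agree, as both extend `g`
  have hagree : ∀ z ∈ ball (0 : ℂ) R, EqOn (s z) g (ball z η ∩ ball 0 R) := fun z hz =>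
    IsSectionOn.eqOn hD hF hF' (isOpen_ball.inter isOpen_ball)
      ((convex_ball z η).inter (convex_ball 0 R)).isPreconnected
      ((hs z hz).mono inter_subset_left) (hg.mono inter_subset_right)
      ⟨mem_ball_self hη, hz⟩ (hsg z hz)
  refine ⟨fun z => s (t * z) z, ?_, ?_⟩
  · refine isSectionOn_diagonal (U := fun z => ball (t * z) η) (s := fun z => s (t * z))
      (fun z _ => isOpen_ball) htη (fun z hz => hs _ (htR z hz)) fun z hz => ?_
    have hc : Continuous fun y : ℂ => (t : ℂ) * y := by fun_prop
    filter_upwards [isOpen_ball.mem_nhds hz, isOpen_ball.mem_nhds (htη z hz),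
      hc.continuousAt.eventually (ball_mem_nhds ((t : ℂ) * z) hη)] with y hy hyz hty
    have hyR := htR y hy
    refine IsSectionOn.eqOn hD hF hF' (isOpen_ball.inter isOpen_ball)
      ((convex_ball ((t : ℂ) * y) η).inter (convex_ball ((t : ℂ) * z) η)).isPreconnected
      ((hs _ hyR).mono inter_subset_left) ((hs _ (htR z hz)).mono inter_subset_right)
      (z := t * y) ⟨mem_ball_self hη, hty⟩ ?_ ⟨htη y hy, hyz⟩
    rw [hsg _ hyR, hagree _ (htR z hz) ⟨hty, hyR⟩]
  · simp [hsg 0 (mem_ball_self hR)]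

/-- Sections through a fixed point over all discs of radius less than one define a section over
the unit disc. -/
lemma exists_section_openUnitDisc (hD : IsOpen D) (hF : DifferentiableOn ℂ F D)
    (hF' : ∀ z ∈ D, deriv F z ≠ 0)
    (h : ∀ R : ℝ, 0 < R → R < 1 → ∃ g, IsSectionOn D F g (ball 0 R) ∧ g 0 = w) :
    ∃ g, IsSectionOn D F g openUnitDisc ∧ g 0 = w := by
  choose! g hg hg0 using h
  have hr : ∀ z ∈ openUnitDisc, 0 < (1 + ‖z‖) / 2 ∧ (1 + ‖z‖) / 2 < 1 ∧ ‖z‖ < (1 + ‖z‖) / 2 := by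
    intro z hz
    have := mem_openUnitDisc.1 hz
    have := norm_nonneg z
    refine ⟨?_, ?_, ?_⟩ <;> linarith
  refine ⟨fun z => g ((1 + ‖z‖) / 2) z, ?_, ?_⟩
  · refine isSectionOn_diagonal (U := fun z => ball 0 ((1 + ‖z‖) / 2))
      (s := fun z => g ((1 + ‖z‖) / 2)) (fun z _ => isOpen_ball)
      (fun z hz => mem_ball_zero_iff.2 (hr z hz).2.2)
      (fun z hz => hg _ (hr z hz).1 (hr z hz).2.1) fun z hz => ?_
    filter_upwards [isOpen_openUnitDisc.mem_nhds hz,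
      isOpen_ball.mem_nhds (mem_ball_zero_iff.2 (hr z hz).2.2)] with y hy hyz
    have hy' := hr y hy
    have hz' := hr z hz
    refine IsSectionOn.eqOn hD hF hF' (isOpen_ball.inter isOpen_ball)
      ((convex_ball 0 ((1 + ‖y‖) / 2)).inter (convex_ball 0 ((1 + ‖z‖) / 2))).isPreconnected
      ((hg _ hy'.1 hy'.2.1).mono inter_subset_left) ((hg _ hz'.1 hz'.2.1).mono inter_subset_right)
      (z := 0) ⟨mem_ball_self hy'.1, mem_ball_self hz'.1⟩ ?_ ⟨mem_ball_zero_iff.2 hy'.2.2, hyz⟩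
    rw [hg0 _ hy'.1 hy'.2.1, hg0 _ hz'.1 hz'.2.1]
  · exact hg0 _ (by simp) (by norm_num)

/-! ### Distance estimate along a section -/

/-- A function which does not increase the hyperbolic metric infinitesimally at most doubles
hyperbolic distances from the origin. The factor two, `2 * t / (1 + t ^ 2) = tanh (2 * artanh t)`,
makes the comparison function a strict supersolution. -/
lemma norm_le_of_norm_deriv_le {φ : ℂ → ℂ} {R : ℝ} (hR : R ≤ 1)
    (hφ : DifferentiableOn ℂ φ (ball 0 R)) (h0 : φ 0 = 0)
    (hle : ∀ z ∈ ball (0 : ℂ) R, ‖deriv φ z‖ ≤ (1 - ‖φ z‖ ^ 2) / (1 - ‖z‖ ^ 2)) {z : ℂ}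
    (hz : z ∈ ball (0 : ℂ) R) : ‖φ z‖ ≤ 2 * ‖z‖ / (1 + ‖z‖ ^ 2) := by
  rcases eq_or_ne z 0 with rfl | hz0
  · simp [h0]
  set r := ‖z‖ with hrdef
  have hr : 0 < r := norm_pos_iff.2 hz0
  have hzR : r < R := mem_ball_zero_iff.1 hz
  have hn : ∀ t ∈ Icc (0 : ℝ) 1, ‖(t : ℂ) * z‖ = t * r := fun t ht => by
    rw [norm_mul, Complex.norm_real, Real.norm_of_nonneg ht.1]
  have hball : ∀ t ∈ Icc (0 : ℝ) 1, (t : ℂ) * z ∈ ball (0 : ℂ) R := fun t ht => by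
    rw [mem_ball_zero_iff, hn t ht]
    nlinarith [ht.1, ht.2]
  have hder : ∀ t ∈ Icc (0 : ℝ) 1,
      HasDerivAt (fun t : ℝ => φ (t * z)) (deriv φ (t * z) * z) t := fun t ht => by
    have h1 : HasDerivAt (fun t : ℝ => (t : ℂ) * z) z t := by
      simpa using (Complex.ofRealCLM.hasDerivAt (x := t)).mul_const z
    exact ((hφ.differentiableAt (isOpen_ball.mem_nhds (hball t ht))).hasDerivAt).comp t h1
  have hB : ∀ t : ℝ, HasDerivAt (fun t : ℝ => 2 * (t * r) / (1 + (t * r) ^ 2))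
      (2 * r * (1 - (t * r) ^ 2) / (1 + (t * r) ^ 2) ^ 2) t := fun t => by
    have hp : 1 + (t * r) ^ 2 ≠ 0 := by positivity
    have h1 : HasDerivAt (fun t : ℝ => t * r) r t := by
      simpa using (hasDerivAt_id t).mul_const r
    have h2 := (h1.const_mul 2).fun_div ((h1.fun_pow 2).const_add 1) hp
    refine h2.congr_deriv ?_
    congr 1
    push_cast
    ring
  have := image_norm_le_of_norm_deriv_right_lt_deriv_boundary (a := 0) (b := 1)
    (fun t ht => (hder t ht).continuousAt.continuousWithinAt)
    (fun t ht => (hder t (Ico_subset_Icc_self ht)).hasDerivWithinAt) (by simp [h0]) hB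
    (fun t ht heq => ?_) (right_mem_Icc.2 zero_le_one)
  · simpa using this
  · have ht' := Ico_subset_Icc_self ht
    have h1 := hle _ (hball t ht')
    rw [hn t ht', heq] at h1
    set x := t * r with hx
    have hx0 : 0 ≤ x := mul_nonneg ht'.1 hr.le
    have hx1 : x < 1 := by nlinarith [ht'.1, ht'.2]
    have hx2 : 0 < 1 - x ^ 2 := by nlinarith
    have e : (1 - (2 * x / (1 + x ^ 2)) ^ 2) / (1 - x ^ 2) = (1 - x ^ 2) / (1 + x ^ 2) ^ 2 := by
      field_simp
      ring
    rw [e] at h1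
    have hpos : 0 < (1 - x ^ 2) / (1 + x ^ 2) ^ 2 := by positivity
    calc ‖deriv φ (t * z) * z‖ = ‖deriv φ (t * z)‖ * r := norm_mul _ _
      _ ≤ (1 - x ^ 2) / (1 + x ^ 2) ^ 2 * r := by gcongr
      _ < 2 * ((1 - x ^ 2) / (1 + x ^ 2) ^ 2 * r) := by linarith [mul_pos hpos hr]
      _ = 2 * r * (1 - x ^ 2) / (1 + x ^ 2) ^ 2 := by ring

/-- A section of an extremal function is an infinitesimal contraction for every map to the
disc. -/
lemma IsSectionOn.norm_discAut_le (hD : IsOpen D) (hF : F ∈ holToDisc D)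
    (hFe : ∀ z ∈ D, IsExtremalAt D F z) {g : ℂ → ℂ} {R : ℝ} (hR : R ≤ 1)
    (hg : IsSectionOn D F g (ball 0 R)) (hG : G ∈ holToDisc D) {z : ℂ}
    (hz : z ∈ ball (0 : ℂ) R) :
    ‖discAut (G (g 0)) (G (g z))‖ ≤ 2 * ‖z‖ / (1 + ‖z‖ ^ 2) := by
  have h0 : (0 : ℂ) ∈ ball (0 : ℂ) R := mem_ball_self (pos_of_mem_ball hz)
  set Φ : ℂ → ℂ := fun p => discAut (G (g 0)) (G p) with hΦdef
  have hΦ : Φ ∈ holToDisc D := discAut_comp_mem (norm_lt_one_of_mem hG (hg.2.1 h0)) hG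
  refine norm_le_of_norm_deriv_le (φ := fun z => Φ (g z)) hR (hΦ.1.comp hg.1 hg.2.1)
    (discAut_self _) (fun y hy => ?_) hz
  have hp := hg.2.1 hy
  have hgy := (hg.1.differentiableAt (isOpen_ball.mem_nhds hy)).hasDerivAt
  have hFy := (hF.1.differentiableAt (hD.mem_nhds hp)).hasDerivAt
  have hΦy := (hΦ.1.differentiableAt (hD.mem_nhds hp)).hasDerivAt
  have hone : deriv F (g y) * deriv g y = 1 := by
    refine (hFy.comp y hgy).unique ((hasDerivAt_id y).congr_of_eventuallyEq ?_)
    filter_upwards [isOpen_ball.mem_nhds hy] with x hx using hg.2.2 x hx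
  have hone' : ‖deriv F (g y)‖ * ‖deriv g y‖ = 1 := by rw [← norm_mul, hone, norm_one]
  have hden := (hFe _ hp).hypDensity_le hD hp hΦ
  have hΦ1 := norm_lt_one_of_mem hΦ hp
  have hpos : 0 < 1 - ‖Φ (g y)‖ ^ 2 := by nlinarith [norm_nonneg (Φ (g y))]
  rw [hypDensity, hypDensity, hg.2.2 y hy, div_le_iff₀ hpos] at hden
  have hcomp : deriv (fun z => Φ (g z)) y = deriv Φ (g y) * deriv g y := (hΦy.comp y hgy).deriv
  rw [hcomp, norm_mul]
  calc ‖deriv Φ (g y)‖ * ‖deriv g y‖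
      ≤ ‖deriv F (g y)‖ / (1 - ‖y‖ ^ 2) * (1 - ‖Φ (g y)‖ ^ 2) * ‖deriv g y‖ := by gcongr
    _ = ‖deriv F (g y)‖ * ‖deriv g y‖ * (1 - ‖Φ (g y)‖ ^ 2) / (1 - ‖y‖ ^ 2) := by ring
    _ = (1 - ‖Φ (g y)‖ ^ 2) / (1 - ‖y‖ ^ 2) := by rw [hone', one_mul]

lemma IsSectionOn.caratheodoryDist_lt (hD : IsOpen D) (hF : F ∈ holToDisc D)
    (hFe : ∀ z ∈ D, IsExtremalAt D F z) {g : ℂ → ℂ} {R' R : ℝ}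
    (hR'R : R' ≤ R) (hR : R < 1) (hg : IsSectionOn D F g (ball 0 R')) {z : ℂ}
    (hz : z ∈ ball (0 : ℂ) R') :
    caratheodoryDist D (g 0) (g z) <
      ENNReal.ofReal (Real.artanh (2 * R / (1 + R ^ 2)) + 1) := by
  have hR0 : 0 < R := (pos_of_mem_ball hz).trans_le hR'R
  have hzR : ‖z‖ < R := (mem_ball_zero_iff.1 hz).trans_le hR'R
  have hnn : 0 ≤ Real.artanh (2 * R / (1 + R ^ 2)) := Real.artanh_nonneg (by positivity)
  have hle : caratheodoryDist D (g 0) (g z) ≤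
      ENNReal.ofReal (Real.artanh (2 * R / (1 + R ^ 2))) := by
    refine iSup₂_le fun G hG => ENNReal.ofReal_le_ofReal ?_
    rw [hypDist_eq]
    refine Real.artanh_le_artanh (by linarith [norm_nonneg (discAut (G (g 0)) (G (g z)))]) ?_
      ((hg.norm_discAut_le hD hF hFe (hR'R.trans hR.le) hG hz).trans ?_)
    · rw [div_lt_one (by positivity)]
      nlinarith
    · rw [div_le_div_iff₀ (by positivity) (by positivity)]
      have : 0 ≤ (R - ‖z‖) * (1 - R * ‖z‖) :=
        mul_nonneg (by linarith) (by nlinarith [norm_nonneg z])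
      nlinarith
  exact hle.trans_lt ((ENNReal.ofReal_lt_ofReal_iff (by linarith)).2 (by linarith))

/-! ### Finitely compact domains -/

lemma caratheodoryDist_eq_zero_of_forall_eq {z : ℂ} (h : ∀ G ∈ holToDisc D, G z = G w) :
    caratheodoryDist D w z = 0 := by
  refine le_antisymm (iSup₂_le fun G hG => ?_) bot_le
  rw [hypDist_eq, h G hG, discAut_self, norm_zero, Real.artanh_zero, ENNReal.ofReal_zero]

/-- On a `c`-finitely compact domain extremal functions have no critical points: otherwise all
bounded holomorphic functions are constant, and the whole domain is a ball of finite radius. -/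
lemma IsCFinitelyCompact.deriv_ne_zero (hD : IsPlanarDomain D) (hc : IsCFinitelyCompact D)
    (hw : w ∈ D) (hF : IsExtremalAt D F w) : deriv F w ≠ 0 := by
  obtain ⟨hDo, hDn, hDc⟩ := hD
  intro h0
  have hconst : ∀ G ∈ holToDisc D, ∀ z ∈ D, G z = G w := by
    intro G hG
    by_contra! hne
    obtain ⟨z, hz, hne⟩ := hne
    obtain ⟨H, h1, h2, h3, h4⟩ := exists_norm_deriv_lt hDo hDc (h := fun _ => 0)
      (f := fun z => (G z - G w) / 2) (differentiableOn_const 0)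
      ((hG.1.sub_const _).div_const 2) hw rfl (by simp) (fun y hy => by
        have h1 := norm_lt_one_of_mem hG hy
        have h2 := norm_lt_one_of_mem hG hw
        have h3 := norm_sub_le (G y) (G w)
        rw [norm_zero, zero_add, norm_div, Complex.norm_ofNat]
        linarith) ⟨z, hz, by simpa [sub_eq_zero] using hne⟩
    have := hF H h1 h2 h3
    rw [hypDensity, h0, norm_zero, zero_div] at this
    simp only [deriv_const, norm_zero] at h4
    linarith
  have hball : {z ∈ D | caratheodoryDist D w z < ENNReal.ofReal 1} = D := by
    refine sep_eq_self_iff_mem_true.2 fun z hz => ?_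
    rw [caratheodoryDist_eq_zero_of_forall_eq fun G hG => hconst G hG z hz]
    simp
  obtain ⟨hK, hKD⟩ := hc w hw 1 one_pos
  rw [hball] at hK hKD
  have hcl : IsClosed D := isClosed_of_closure_subset hKD
  rw [hcl.closure_eq, IsClopen.eq_univ ⟨hcl, hDo⟩ hDn] at hK
  exact noncompact_univ ℂ hK

/-- On a `c`-finitely compact domain, sections of an everywhere extremal function extend to all
discs of radius less than one: they take values in a fixed compact set, so that each continuation
step gains a fixed amount. -/
lemma exists_section_ball (hD : IsPlanarDomain D) (hc : IsCFinitelyCompact D)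
    (hF : F ∈ holToDisc D) (hFe : ∀ z ∈ D, IsExtremalAt D F z) (hw : w ∈ D) (hFw : F w = 0)
    {R : ℝ} (hR0 : 0 < R) (hR1 : R < 1) :
    ∃ g, IsSectionOn D F g (ball 0 R) ∧ g 0 = w := by
  have hF' : ∀ z ∈ D, deriv F z ≠ 0 := fun z hz => hc.deriv_ne_zero hD hz (hFe z hz)
  have hr : 0 < Real.artanh (2 * R / (1 + R ^ 2)) + 1 := by
    have := Real.artanh_nonneg (x := 2 * R / (1 + R ^ 2)) (by positivity)
    linarith
  obtain ⟨hK, hKD⟩ := hc w hw _ hr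
  obtain ⟨η, hη, hsec⟩ := exists_section_of_isCompact hD.1 hF.1 hF' hK hKD
  have hwK : caratheodoryDist D w w < ENNReal.ofReal (Real.artanh (2 * R / (1 + R ^ 2)) + 1) := by
    rw [caratheodoryDist_eq_zero_of_forall_eq fun _ _ => rfl]
    exact ENNReal.ofReal_pos.2 hr
  have key : ∀ n : ℕ, ∃ g, IsSectionOn D F g (ball 0 (min R ((n + 1) * (η / 2)))) ∧ g 0 = w := by
    intro n
    induction n with
    | zero =>
      obtain ⟨s, hs, hsw⟩ := hsec w (subset_closure ⟨hw, hwK⟩)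
      rw [hFw] at hs hsw
      refine ⟨s, hs.mono (ball_subset_ball ((min_le_right _ _).trans ?_)), hsw⟩
      simp
      linarith
    | succ n ih =>
      obtain ⟨g, hg, hg0⟩ := ih
      have hρ : 0 < min R ((n + 1) * (η / 2)) := lt_min hR0 (by positivity)
      obtain ⟨g', hg', hg'0⟩ := hg.exists_extension hD.1 hF.1 hF' hρ hη fun z hz => by
        have hzK := hg.caratheodoryDist_lt hD.1 hF hFe (min_le_left _ _) hR1 hz
        rw [hg0] at hzK
        obtain ⟨s, hs, hsz⟩ := hsec (g z) (subset_closure ⟨hg.2.1 hz, hzK⟩)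
        rw [hg.2.2 z hz] at hs hsz
        exact ⟨s, hs, hsz⟩
      refine ⟨g', hg'.mono (ball_subset_ball ?_), hg'0.trans hg0⟩
      push_cast
      rcases min_cases R ((n + 1) * (η / 2)) with h | h
      · rw [h.1]
        exact (min_le_left _ _).trans (by linarith)
      · rw [h.1]
        exact (min_le_right _ _).trans (by linarith)
  obtain ⟨n, hn⟩ := exists_nat_gt (R / (η / 2))
  obtain ⟨g, hg, hg0⟩ := key n
  rw [div_lt_iff₀ (by positivity)] at hn
  rw [min_eq_left (by linarith)] at hg
  exact ⟨g, hg, hg0⟩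

/-- On a `c`-finitely compact domain an everywhere extremal function that vanishes somewhere is
biholomorphic: its global section over the disc is also a left inverse, by the identity theorem. -/
lemma isBiholomorphic_of_isExtremalAt (hD : IsPlanarDomain D) (hc : IsCFinitelyCompact D)
    (hF : F ∈ holToDisc D) (hFe : ∀ z ∈ D, IsExtremalAt D F z) (hw : w ∈ D) (hFw : F w = 0) :
    IsBiholomorphic D openUnitDisc := by
  have hF' : ∀ z ∈ D, deriv F z ≠ 0 := fun z hz => hc.deriv_ne_zero hD hz (hFe z hz)
  obtain ⟨g, hg, hg0⟩ := exists_section_openUnitDisc hD.1 hF.1 hF' fun R hR0 hR1 =>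
    exists_section_ball hD hc hF hFe hw hFw hR0 hR1
  refine ⟨F, g, hF.1, hg.1, hF.2, hg.2.1, fun z hz => ?_, hg.2.2⟩
  have hgF : DifferentiableOn ℂ (g ∘ F) D := hg.1.comp hF.1 hF.2
  refine (hgF.analyticOnNhd hD.1).eqOn_of_preconnected_of_eventuallyEq (g := id)
    (differentiableOn_id.analyticOnNhd hD.1) hD.2.isPreconnected hw ?_ hz
  have hDw := hD.1.mem_nhds hw
  obtain ⟨s, hs⟩ := exists_eventually_left_inverse hD.1 hF.1 hw (hF' w hw)
  have hcont : Tendsto (g ∘ F) (𝓝 w) (𝓝 w) := by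
    have := (hgF.continuousOn.continuousAt hDw).tendsto
    rwa [Function.comp_apply, hFw, hg0] at this
  filter_upwards [hs, hcont.eventually hs, hDw] with y hy hy' hyD
  rw [← hy', Function.comp_apply, hg.2.2 _ (hF.2 hyD), hy, id]

theorem theorem4p3 (D : Set ℂ) (hD : IsPlanarDomain D)
    (hfin : ∃ C : Set (ℂ → ℂ), C.Finite ∧ IsInfinitesimalUniversalSet D C) :
    (∃ F : ℂ → ℂ, IsInfinitesimalUniversalSet D {F}) ∧
      (IsCFinitelyCompact D → IsBiholomorphic D openUnitDisc) := by
  obtain ⟨C, hC, hCu⟩ := hfin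
  obtain ⟨F, hF, hFe⟩ := exists_forall_isExtremalAt hD hC hCu
  refine ⟨⟨F, (isInfinitesimalUniversalSet_singleton_iff hD.1).2 ⟨hF, hFe⟩⟩, fun hc => ?_⟩
  obtain ⟨w, hw⟩ := hD.2.nonempty
  have ha := norm_lt_one_of_mem hF hw
  refine isBiholomorphic_of_isExtremalAt (F := fun z => discAut (F w) (F z)) hD hc
    (discAut_comp_mem ha hF) (fun z hz => (hFe z hz).mono ?_) hw (discAut_self _)
  rw [hypDensity_discAut_comp hD.1 ha hF hz]
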